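/- **Conventions.** For a completely regular Hausdorff space $Z$, let $C_b(Z)$ be the space of bounded continuous functions $Z\to\mathbb R$, let $\mathcal U(Z)$ be the algebra of subsets of $Z$ generated by the zero-sets $f^{-1}(0)$ ($f:Z\to\mathbb R$ continuous), and let $\mathcal B(Z)$ be the Borel $\sigma$-algebra. Let $\mathcal M^1(Z)$ be the set of finitely additive functions $\gamma:\mathcal U(Z)\to[0,\infty)$ with $\gamma(Z)=1$ that are regular: for all $A\in\mathcal U(Z)$ and $\varepsilon>0$ there is a zero-set $F\subseteq A$ with $\gamma(B)<\varepsilon$ for every $B\in\mathcal U(Z)$, $B\subseteq A\setminus F$. For $f\in C_b(Z)$ the integral $\int_Z f\,d\gamma$ is the supremum of $\sum_i a_i\gamma(A_i)$ over all step functions $\sum_i a_i\mathbf 1_{A_i}\le f$ with $(A_i)$ a finite partition of $Z$ into members of $\mathcal U(Z)$. Let $lsc_{bi}(Z)$ be the set of lower semicontinuous functions $g:Z\to\mathbb R\cup\{+\infty\}$ that are bounded from below and not identically $+\infty$; for $g\in lsc_{bi}(Z)$ and $\gamma\in\mathcal M^1(Z)$ put $\int_Z g\,d\gamma:=\sup\{\int_Z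 f\,d\gamma: f\in C_b(Z),\ f\le g\}$. A Borel probability measure $\gamma$ on $Z$ is Radon if for all $B\in\mathcal B(Z)$ and $\varepsilon>0$ there is a compact $K\subseteq B$ with $\gamma(B\setminus K)<\varepsilon$; its integrals are the usual ones. For Radon probability measures $\mu$ on $X$ and $\nu$ on $Y$, let $\Pi(\mu,\nu)$ be the set of Radon probability measures on $\mathcal B(X\times Y)$ with marginals $\mu$ and $\nu$, and let $$\Gamma(\mu,\nu)=\Bigl\{\gamma\in\mathcal M^1(X\times Y):\ \int_{X\times Y}\bigl(\varphi(x)+\psi(y)\bigr)\,d\gamma(x,y)=\int_X\varphi\,d\mu+\int_Y\psi\,d\nu\ \ \forall\varphi\in C_b(X),\ \psi\in C_b(Y)\Bigr\}.$$ For $c\in lsc_{bi}(X\times Y)$ consider $$(\mathrm{OP})\quad v(\mathrm{OP})=\inf_{\gamma\in\Gamma(\mu,\nu)}\int_{X\times Y} c\,d\gamma,\qquad (\mathrm{KP})\quad v(\mathrm{KP})=\inf_{\gamma\in\Pi(\mu,\nu)}\int_{X\times Y} c\,d\gamma .$$ **Theorem.** Let $X$ and $Y$ be perfectly normal Hausdorff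 spaces and let $\mu$, $\nu$ be Radon probability measures on $X$, $Y$. Then $\Gamma(\mu,\nu)=\Pi(\mu,\nu)$, in the sense that restriction of measures from $\mathcal B(X\times Y)$ to $\mathcal U(X\times Y)$ is a bijection from $\Pi(\mu,\nu)$ onto $\Gamma(\mu,\nu)$. Consequently (OP) and (KP) coincide for every $c\in lsc_{bi}(X\times Y)$: the integral of $c$ against each $\gamma\in\Pi(\mu,\nu)$ equals its integral against the restriction of $\gamma$ to $\mathcal U(X\times Y)$, and $v(\mathrm{OP})=v(\mathrm{KP})$. Moreover, if $c\in lsc_{bi}(X\times Y)$ and $v(\mathrm{KP})<+\infty$, then (KP) has a solution: there is $\gamma^*\in\Pi(\mu,\nu)$ with $\int_{X\times Y} c\,d\gamma^*=v(\mathrm{KP})$. -/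

import Mathlib

open MeasureTheory Set BoundedContinuousFunction

noncomputable section

namespace KantorovichCharge

universe u v

section Charges

variable (Z : Type u) [TopologicalSpace Z]

/-- The zero-sets of `Z`: the sets `f ⁻¹' {0}` with `f : Z → ℝ` continuous. -/
def zeroSets : Set (Set Z) := {A | ∃ f : C(Z, ℝ), A = f ⁻¹' {0}}

/-- The algebra `𝒰(Z)` of subsets of `Z` generated by the zero-sets. -/
def zeroAlgebra : Set (Set Z) := generateSetAlgebra (zeroSets Z)

theorem univ_mem_zeroAlgebra : (univ : Set Z) ∈ zeroAlgebra Z :=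
  isSetAlgebra_generateSetAlgebra.univ_mem

variable {Z}

/-- The space `ℳ(Z)`: real set functions on the algebra `𝒰(Z)` that are finitely additive,
uniformly bounded, and (inner) regular with respect to the zero-sets. -/
structure IsRegularCharge (m : zeroAlgebra Z → ℝ) : Prop where
  additive : ∀ A B C : zeroAlgebra Z, Disjoint (A : Set Z) (B : Set Z) →
    (C : Set Z) = (A : Set Z) ∪ (B : Set Z) → m C = m A + m B
  bounded : ∃ M : ℝ, ∀ A : zeroAlgebra Z, |m A| ≤ M
  regular : ∀ A : zeroAlgebra Z, ∀ ε : ℝ, 0 < ε → ∃ F ∈ zeroSets Z, F ⊆ (A : Set Z) ∧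
    ∀ B : zeroAlgebra Z, (B : Set Z) ⊆ (A : Set Z) \ F → |m B| < ε

variable (Z) in
/-- `ℳ¹(Z)`: the non-negative regular charges of total mass one. -/
def unitCharges : Set (zeroAlgebra Z → ℝ) :=
  {m | IsRegularCharge m ∧ (∀ A, 0 ≤ m A) ∧ m ⟨univ, univ_mem_zeroAlgebra Z⟩ = 1}

/-- The integrals `∑ aᵢ m(Aᵢ)` of the step functions `∑ aᵢ 1_{Aᵢ} ≤ f`, where `A₁, …, Aₙ` is a
finite partition of `Z` into members of `𝒰(Z)`. -/
def lowerSums (m : zeroAlgebra Z → ℝ) (f : Z →ᵇ ℝ) : Set ℝ :=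
  {r | ∃ (n : ℕ) (A : Fin n → zeroAlgebra Z) (a : Fin n → ℝ),
    Pairwise (fun i j => Disjoint (A i : Set Z) (A j : Set Z)) ∧
    (⋃ i, (A i : Set Z)) = univ ∧
    (∀ i, ∀ z ∈ (A i : Set Z), a i ≤ f z) ∧
    r = ∑ i, a i * m (A i)}

/-- The integral `∫ f dm` of a bounded continuous function against a non-negative charge `m`
on `𝒰(Z)`: the supremum of the integrals of the step functions below `f`. (A bounded continuous
function is a uniform limit of `𝒰(Z)`-step functions, so the supremum from below agrees with the
infimum from above and with the limit along any uniformly convergent sequence of step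
functions.) -/
def chargeIntegral (m : zeroAlgebra Z → ℝ) (f : Z →ᵇ ℝ) : ℝ := sSup (lowerSums m f)

variable (Z) in
/-- Proper, bounded from below, lower semicontinuous functions `Z → ℝ ∪ {+∞}`. -/
def lscBoundedBelow : Set (Z → EReal) :=
  {g | LowerSemicontinuous g ∧ (∃ b : ℝ, ∀ z, (b : EReal) ≤ g z) ∧ ∃ z, g z ≠ ⊤}

/-- The (lower) integral `∫ g dm = sup {∫ f dm : f ∈ C_b(Z), f ≤ g}` of a function bounded from
below against a non-negative charge. -/
def chargeLowerIntegral (m : zeroAlgebra Z → ℝ) (g : Z → EReal) : EReal :=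
  ⨆ (f : Z →ᵇ ℝ) (_ : ∀ z, ((f z : ℝ) : EReal) ≤ g z), ((chargeIntegral m f : ℝ) : EReal)

end Charges

section Measures

/-- The Borel measures on `Z`, that is, the measures on the `σ`-algebra generated by the topology.
It is needed for `Z = X × Y`, where the Borel `σ`-algebra can be larger than the product
`σ`-algebra. -/
abbrev BorelMeasure (Z : Type u) [TopologicalSpace Z] : Type u := @Measure Z (borel Z)

variable {Z : Type u} [TopologicalSpace Z]

/-- Radon probability measures: every Borel set is approximated in measure from inside by
compact sets. -/
def IsRadonProbability [MeasurableSpace Z] (γ : Measure Z) : Prop :=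
  IsProbabilityMeasure γ ∧
    ∀ B : Set Z, MeasurableSet B → ∀ ε : ENNReal, 0 < ε →
      ∃ K : Set Z, IsCompact K ∧ K ⊆ B ∧ γ (B \ K) < ε

/-- The usual integral `∫ g⁺ dγ - ∫ g⁻ dγ` of an extended real valued function. For `γ` finite and
`g` bounded from below the second term is finite. -/
def extIntegral [MeasurableSpace Z] (γ : Measure Z) (g : Z → EReal) : EReal :=
  ((∫⁻ z, (g z).toENNReal ∂γ : ENNReal) : EReal) -
    ((∫⁻ z, (-g z).toENNReal ∂γ : ENNReal) : EReal)

/-- The set function on `𝒰(Z)` that a Borel measure induces by restriction. -/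
def toCharge (γ : BorelMeasure Z) : zeroAlgebra Z → ℝ := fun A => (γ (A : Set Z)).toReal

end Measures

section Transport

variable {X : Type u} {Y : Type v} [TopologicalSpace X] [TopologicalSpace Y]
  [MeasurableSpace X] [MeasurableSpace Y]

/-- The function `(φ ⊕ ψ)(x, y) = φ x + ψ y`. -/
def oplus (φ : X →ᵇ ℝ) (ψ : Y →ᵇ ℝ) : (X × Y) →ᵇ ℝ :=
  φ.compContinuous ⟨Prod.fst, continuous_fst⟩ + ψ.compContinuous ⟨Prod.snd, continuous_snd⟩

/-- `Γ(μ, ν)`: the charges `γ ∈ ℳ¹(X × Y)` with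
`∫ φ ⊕ ψ dγ = ∫ φ dμ + ∫ ψ dν` for all bounded continuous `φ`, `ψ`. -/
def chargePlans (μ : Measure X) (ν : Measure Y) : Set (zeroAlgebra (X × Y) → ℝ) :=
  {γ | γ ∈ unitCharges (X × Y) ∧ ∀ (φ : X →ᵇ ℝ) (ψ : Y →ᵇ ℝ),
    chargeIntegral γ (oplus φ ψ) = (∫ x, φ x ∂μ) + ∫ y, ψ y ∂ν}

/-- `Π(μ, ν)`: the transport plans, i.e. the Radon probability measures on the Borel
`σ`-algebra of `X × Y` whose push-forwards under the projections are `μ` and `ν`. -/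
def transportPlans (μ : Measure X) (ν : Measure Y) : Set (BorelMeasure (X × Y)) :=
  {γ | @IsRadonProbability (X × Y) _ (borel (X × Y)) γ ∧
    @Measure.map (X × Y) X (borel (X × Y)) _ Prod.fst γ = μ ∧
    @Measure.map (X × Y) Y (borel (X × Y)) _ Prod.snd γ = ν}

/-- The cost `∫ c dγ` of a Borel measure on `X × Y`. -/
def planCost (c : X × Y → EReal) (γ : BorelMeasure (X × Y)) : EReal :=
  @extIntegral (X × Y) (borel (X × Y)) γ c

/-- The value of the problem (OP): minimize `∫ c dγ` over `γ ∈ Γ(μ, ν)`. -/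
def valueOP (μ : Measure X) (ν : Measure Y) (c : X × Y → EReal) : EReal :=
  ⨅ γ ∈ chargePlans μ ν, chargeLowerIntegral γ c

/-- The value of the problem (KP): minimize `∫ c dγ` over `γ ∈ Π(μ, ν)`. -/
def valueKP (μ : Measure X) (ν : Measure Y) (c : X × Y → EReal) : EReal :=
  ⨅ γ ∈ transportPlans μ ν, planCost c γ

end Transport

end KantorovichCharge

end

/-!
A charge in `Γ(μ, ν)` and a transport plan in `Π(μ, ν)` are both determined by the mean they induce
on `C_b(X × Y)`: the former since the indicator of a zero-set is approximated from above by bounded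
continuous functions separating it from a zero-set in its complement, the latter since a Radon
measure is inner regular on open sets. It remains to represent every mean with marginals `μ` and `ν`
by a transport plan. Such a mean is tight: given compact `K ⊆ X` and `L ⊆ Y` carrying most of `μ`
and `ν`, a function vanishing on `K × L` is small on an open rectangle around `K × L`, and off this
rectangle it is dominated by a sum of two functions of one variable each, whose means are prescribed
by `μ` and `ν`. By the Riesz representation theorem a mean is a regular measure on the Stone–Čech
compactification of `X × Y`; tightness says that this measure is carried by a countable union of
compact subsets of `X × Y`, so it is the image of a Radon measure on `X × Y`.

Inner regularity also gives `∫ c dγ = sup {∫ f dγ : f ∈ C_b, f ≤ c}` for lower semicontinuous `c`.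
Hence the cost is a supremum of evaluations of the mean, so it is lower semicontinuous for pointwise
convergence, in which the means with prescribed marginals form a compact set.
-/

namespace KantorovichCharge

section ZeroSets

variable {Z : Type*} [TopologicalSpace Z]

theorem preimage_mem_zeroSets {W : Type*} [TopologicalSpace W] [PerfectlyNormalSpace W]
    {f : Z → W} (hf : Continuous f) {s : Set W} (hs : IsClosed s) : f ⁻¹' s ∈ zeroSets Z := by
  obtain ⟨g, rfl, -⟩ := perfectlyNormalSpace_iff_forall_isClosed_preimage_zero.1 ‹_› s hs
  exact ⟨g.comp ⟨f, hf⟩, rfl⟩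

theorem isClosed_of_mem_zeroSets {F : Set Z} (hF : F ∈ zeroSets Z) : IsClosed F := by
  obtain ⟨f, rfl⟩ := hF
  exact isClosed_singleton.preimage f.continuous

theorem empty_mem_zeroSets : (∅ : Set Z) ∈ zeroSets Z :=
  ⟨1, by ext z; simp⟩

theorem univ_mem_zeroSets : (univ : Set Z) ∈ zeroSets Z :=
  ⟨0, by ext z; simp⟩

theorem union_mem_zeroSets {F G : Set Z} (hF : F ∈ zeroSets Z) (hG : G ∈ zeroSets Z) :
    F ∪ G ∈ zeroSets Z := by
  obtain ⟨f, rfl⟩ := hF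
  obtain ⟨g, rfl⟩ := hG
  exact ⟨f * g, by ext z; simp⟩

theorem inter_mem_zeroSets {F G : Set Z} (hF : F ∈ zeroSets Z) (hG : G ∈ zeroSets Z) :
    F ∩ G ∈ zeroSets Z := by
  obtain ⟨f, rfl⟩ := hF
  obtain ⟨g, rfl⟩ := hG
  rw [← mk_preimage_prod, singleton_prod_singleton]
  exact preimage_mem_zeroSets (by fun_prop) isClosed_singleton

theorem exists_boundedContinuous_of_disjoint_zeroSets {F G : Set Z} (hF : F ∈ zeroSets Z)
    (hG : G ∈ zeroSets Z) (hFG : Disjoint F G) :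
    ∃ f : Z →ᵇ ℝ, EqOn f 1 F ∧ EqOn f 0 G ∧ ∀ z, f z ∈ Icc (0 : ℝ) 1 := by
  obtain ⟨p, rfl⟩ := hF
  obtain ⟨q, rfl⟩ := hG
  have hpos : ∀ z, 0 < |p z| + |q z| := fun z => by
    by_contra! h
    have hp : p z = 0 := abs_nonpos_iff.1 (by linarith [abs_nonneg (q z)])
    have hq : q z = 0 := abs_nonpos_iff.1 (by linarith [abs_nonneg (p z)])
    exact disjoint_left.1 hFG hp hq
  have hIcc : ∀ z, |q z| / (|p z| + |q z|) ∈ Icc (0 : ℝ) 1 := fun z =>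
    ⟨by positivity, (div_le_one (hpos z)).2 (by linarith [abs_nonneg (p z)])⟩
  refine ⟨.ofNormedAddCommGroup (fun z => |q z| / (|p z| + |q z|)) ?_ 1 fun z => ?_,
    fun z (hz : p z = 0) => ?_, fun z (hz : q z = 0) => ?_, hIcc⟩
  · exact Continuous.div (by fun_prop) (by fun_prop) fun z => (hpos z).ne'
  · rw [Real.norm_eq_abs, abs_of_nonneg (hIcc z).1]
    exact (hIcc z).2
  · have hq := hpos z
    rw [hz, abs_zero, zero_add] at hq
    simp [hz, hq.ne']
  · simp [hz]

theorem mem_zeroAlgebra_of_mem_zeroSets {F : Set Z} (hF : F ∈ zeroSets Z) : F ∈ zeroAlgebra Z :=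
  self_subset_generateSetAlgebra hF

theorem isSetAlgebra_zeroAlgebra : IsSetAlgebra (zeroAlgebra Z) :=
  isSetAlgebra_generateSetAlgebra

instance : Inter (zeroAlgebra Z) :=
  ⟨fun A B => ⟨A ∩ B, isSetAlgebra_zeroAlgebra.inter_mem A.2 B.2⟩⟩

instance : SDiff (zeroAlgebra Z) :=
  ⟨fun A B => ⟨A \ B, isSetAlgebra_zeroAlgebra.sdiff_mem A.2 B.2⟩⟩

instance : Compl (zeroAlgebra Z) :=
  ⟨fun A => ⟨Aᶜ, isSetAlgebra_zeroAlgebra.compl_mem A.2⟩⟩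

@[simp, norm_cast]
theorem coe_inter (A B : zeroAlgebra Z) : ((A ∩ B : zeroAlgebra Z) : Set Z) = ↑A ∩ ↑B := rfl

end ZeroSets

section Charges

variable {Z : Type*} [TopologicalSpace Z] {m : zeroAlgebra Z → ℝ}

/-- Finite partitions of `Z` into members of `𝒰(Z)`, as they occur in `lowerSums`, but with an
arbitrary index type. -/
structure IsZeroPartition {ι : Type*} (A : ι → zeroAlgebra Z) : Prop where
  disjoint : Pairwise fun i j => Disjoint (A i : Set Z) (A j : Set Z)
  iUnion_eq : ⋃ i, (A i : Set Z) = univ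

theorem IsZeroPartition.inter {ι κ : Type*} {A : ι → zeroAlgebra Z} {B : κ → zeroAlgebra Z}
    (hA : IsZeroPartition A) (hB : IsZeroPartition B) :
    IsZeroPartition fun p : ι × κ => A p.1 ∩ B p.2 where
  disjoint := by
    rintro ⟨i, j⟩ ⟨i', j'⟩ h
    rcases eq_or_ne i i' with rfl | hi
    · exact (hB.disjoint fun hj => h (Prod.ext rfl hj)).mono inter_subset_right inter_subset_right
    · exact (hA.disjoint hi).mono inter_subset_left inter_subset_left
  iUnion_eq := by
    simp only [coe_inter, iUnion_prod', ← inter_iUnion, hB.iUnion_eq, inter_univ, hA.iUnion_eq]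

theorem isZeroPartition_cond (A : zeroAlgebra Z) :
    IsZeroPartition fun b : Bool => cond b A Aᶜ where
  disjoint := by
    rintro (_ | _) (_ | _) h
    exacts [absurd rfl h, disjoint_compl_left, disjoint_compl_right, absurd rfl h]
  iUnion_eq := by
    rw [← union_compl_self (A : Set Z), union_eq_iUnion]
    exact iUnion_congr fun b => by cases b <;> rfl

/-- Finitely additive probabilities on `𝒰(Z)`: the members of `ℳ¹(Z)` without the regularity. The
integral is already a positive linear functional at this level. -/
structure IsProbabilityCharge (m : zeroAlgebra Z → ℝ) : Prop where
  additive : ∀ A B C : zeroAlgebra Z, Disjoint (A : Set Z) (B : Set Z) →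
    (C : Set Z) = (A : Set Z) ∪ (B : Set Z) → m C = m A + m B
  nonneg : ∀ A, 0 ≤ m A
  apply_univ : m ⟨univ, univ_mem_zeroAlgebra Z⟩ = 1

theorem isProbabilityCharge_of_mem_unitCharges (hm : m ∈ unitCharges Z) : IsProbabilityCharge m :=
  ⟨hm.1.additive, hm.2.1, hm.2.2⟩

namespace IsProbabilityCharge

theorem apply_of_eq_empty (hm : IsProbabilityCharge m) {A : zeroAlgebra Z} (hA : (A : Set Z) = ∅) :
    m A = 0 := by
  have := hm.additive A A A (by simp [hA]) (by simp)
  linarith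

theorem apply_eq_apply_add_apply_sdiff (hm : IsProbabilityCharge m) {A B : zeroAlgebra Z}
    (h : (A : Set Z) ⊆ B) : m B = m A + m (B \ A) :=
  hm.additive A (B \ A) B disjoint_sdiff_right (union_sdiff_cancel h).symm

theorem apply_compl (hm : IsProbabilityCharge m) (A : zeroAlgebra Z) : m Aᶜ = 1 - m A := by
  have := hm.additive A Aᶜ ⟨univ, univ_mem_zeroAlgebra Z⟩ disjoint_compl_right
    (union_compl_self (A : Set Z)).symm
  rw [hm.apply_univ] at this
  linarith

theorem mono (hm : IsProbabilityCharge m) {A B : zeroAlgebra Z} (h : (A : Set Z) ⊆ B) :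
    m A ≤ m B := by
  rw [hm.apply_eq_apply_add_apply_sdiff h]
  exact le_add_of_nonneg_right (hm.nonneg _)

theorem apply_eq_sum (hm : IsProbabilityCharge m) {ι : Type*} (s : Finset ι) (A : zeroAlgebra Z)
    (B : ι → zeroAlgebra Z) (hd : Pairwise fun i j => Disjoint (B i : Set Z) (B j : Set Z))
    (hA : (A : Set Z) = ⋃ i ∈ s, (B i : Set Z)) : m A = ∑ i ∈ s, m (B i) := by
  classical
  induction s using Finset.induction_on generalizing A with
  | empty => exact hm.apply_of_eq_empty (by simpa using hA)
  | insert i s hi ih =>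
    let C : zeroAlgebra Z := ⟨_, isSetAlgebra_zeroAlgebra.biUnion_mem s fun j _ => (B j).2⟩
    have hiC : Disjoint (B i : Set Z) C := disjoint_iUnion₂_right.2 fun j hj =>
      hd (ne_of_mem_of_not_mem hj hi).symm
    rw [Finset.set_biUnion_insert] at hA
    rw [Finset.sum_insert hi, ← ih C rfl]
    exact hm.additive _ _ _ hiC hA

theorem apply_eq_sum_inter (hm : IsProbabilityCharge m) {ι : Type*} [Fintype ι]
    (A : zeroAlgebra Z) {B : ι → zeroAlgebra Z} (hB : IsZeroPartition B) :
    m A = ∑ i, m (A ∩ B i) :=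
  hm.apply_eq_sum _ _ _
    (fun _ _ hij => (hB.disjoint hij).mono inter_subset_right inter_subset_right)
    (by simp only [Finset.mem_univ, iUnion_true, coe_inter, ← inter_iUnion, hB.iUnion_eq,
      inter_univ])

theorem sum_eq_one (hm : IsProbabilityCharge m) {ι : Type*} [Fintype ι] {A : ι → zeroAlgebra Z}
    (hA : IsZeroPartition A) : ∑ i, m (A i) = 1 := by
  rw [← hm.apply_univ]
  exact (hm.apply_eq_sum _ _ _ hA.disjoint (by simp [hA.iUnion_eq])).symm

end IsProbabilityCharge

theorem sum_mem_lowerSums {f : Z →ᵇ ℝ} {ι : Type*} [Fintype ι] {A : ι → zeroAlgebra Z}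
    (hA : IsZeroPartition A) {a : ι → ℝ} (ha : ∀ i, ∀ z ∈ (A i : Set Z), a i ≤ f z) :
    ∑ i, a i * m (A i) ∈ lowerSums m f := by
  let e := Fintype.equivFin ι
  refine ⟨Fintype.card ι, A ∘ e.symm, a ∘ e.symm, fun i j hij => ?_, ?_, fun i => ha _, ?_⟩
  · exact hA.disjoint (e.symm.injective.ne hij)
  · rw [← hA.iUnion_eq]
    exact e.symm.surjective.iUnion_comp fun i => (A i : Set Z)
  · exact (e.symm.sum_comp fun i => a i * m (A i)).symm

namespace IsProbabilityCharge

theorem add_mem_lowerSums (hm : IsProbabilityCharge m) {f g : Z →ᵇ ℝ} {r s : ℝ}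
    (hr : r ∈ lowerSums m f) (hs : s ∈ lowerSums m g) : r + s ∈ lowerSums m (f + g) := by
  obtain ⟨n, A, a, hAd, hAu, ha, rfl⟩ := hr
  obtain ⟨k, B, b, hBd, hBu, hb, rfl⟩ := hs
  have hA : IsZeroPartition A := ⟨hAd, hAu⟩
  have hB : IsZeroPartition B := ⟨hBd, hBu⟩
  have hmB : ∀ j, m (B j) = ∑ i, m (A i ∩ B j) := fun j => by
    rw [hm.apply_eq_sum_inter (B j) hA]
    exact Finset.sum_congr rfl fun i _ => congrArg m (Subtype.ext (inter_comm _ _))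
  have hsum : ∑ i, a i * m (A i) + ∑ j, b j * m (B j) =
      ∑ p : Fin n × Fin k, (a p.1 + b p.2) * m (A p.1 ∩ B p.2) := by
    simp only [fun i => hm.apply_eq_sum_inter (A i) hB, hmB, Finset.mul_sum, add_mul,
      Finset.sum_add_distrib, Fintype.sum_prod_type]
    congr 1
    exact Finset.sum_comm
  rw [hsum]
  exact sum_mem_lowerSums (hA.inter hB) fun p z hz => add_le_add (ha _ z hz.1) (hb _ z hz.2)

theorem const_mem_lowerSums (hm : IsProbabilityCharge m) {f : Z →ᵇ ℝ} {a : ℝ}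
    (ha : ∀ z, a ≤ f z) : a ∈ lowerSums m f := by
  have h := sum_mem_lowerSums (m := m) (isZeroPartition_cond ⟨univ, univ_mem_zeroAlgebra Z⟩)
    (a := fun _ => a) fun _ z _ => ha z
  rwa [← Finset.mul_sum, hm.sum_eq_one (isZeroPartition_cond _), mul_one] at h

theorem le_of_mem_lowerSums (hm : IsProbabilityCharge m) {f : Z →ᵇ ℝ} {r b : ℝ}
    (hb : ∀ z, f z ≤ b) (hr : r ∈ lowerSums m f) : r ≤ b := by
  obtain ⟨n, A, a, hAd, hAu, ha, rfl⟩ := hr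
  rw [← mul_one b, ← hm.sum_eq_one ⟨hAd, hAu⟩, Finset.mul_sum]
  refine Finset.sum_le_sum fun i _ => ?_
  rcases (A i : Set Z).eq_empty_or_nonempty with h | ⟨z, hz⟩
  · simp [hm.apply_of_eq_empty h]
  · exact mul_le_mul_of_nonneg_right ((ha i z hz).trans (hb z)) (hm.nonneg _)

theorem bddAbove_lowerSums (hm : IsProbabilityCharge m) (f : Z →ᵇ ℝ) : BddAbove (lowerSums m f) :=
  ⟨‖f‖, fun _ => hm.le_of_mem_lowerSums fun z => (le_abs_self _).trans (f.norm_coe_le_norm z)⟩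

theorem nonempty_lowerSums (hm : IsProbabilityCharge m) (f : Z →ᵇ ℝ) : (lowerSums m f).Nonempty :=
  ⟨-‖f‖, hm.const_mem_lowerSums fun z => (abs_le.1 (f.norm_coe_le_norm z)).1⟩

theorem le_chargeIntegral (hm : IsProbabilityCharge m) {f : Z →ᵇ ℝ} {r : ℝ}
    (hr : r ∈ lowerSums m f) : r ≤ chargeIntegral m f :=
  le_csSup (hm.bddAbove_lowerSums f) hr

theorem chargeIntegral_le (hm : IsProbabilityCharge m) {f : Z →ᵇ ℝ} {b : ℝ}
    (hb : ∀ z, f z ≤ b) : chargeIntegral m f ≤ b :=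
  csSup_le (hm.nonempty_lowerSums f) fun _ => hm.le_of_mem_lowerSums hb

theorem add_le_chargeIntegral_add (hm : IsProbabilityCharge m) (f g : Z →ᵇ ℝ) :
    chargeIntegral m f + chargeIntegral m g ≤ chargeIntegral m (f + g) := by
  rw [← le_sub_iff_add_le]
  refine csSup_le (hm.nonempty_lowerSums f) fun r hr => ?_
  rw [le_sub_comm]
  refine csSup_le (hm.nonempty_lowerSums g) fun s hs => ?_
  rw [le_sub_iff_add_le']
  exact hm.le_chargeIntegral (hm.add_mem_lowerSums hr hs)

end IsProbabilityCharge

theorem setOf_floor_eq_mem_zeroAlgebra {f : Z → ℝ} (hf : Continuous f) (k : ℤ) :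
    {z | ⌊f z⌋ = k} ∈ zeroAlgebra Z := by
  have h : {z | ⌊f z⌋ = k} = f ⁻¹' Ici (k : ℝ) \ f ⁻¹' Ici (k + 1 : ℝ) := by
    ext z
    simp [Int.floor_eq_iff]
  rw [h]
  exact isSetAlgebra_zeroAlgebra.sdiff_mem
    (mem_zeroAlgebra_of_mem_zeroSets (preimage_mem_zeroSets hf isClosed_Ici))
    (mem_zeroAlgebra_of_mem_zeroSets (preimage_mem_zeroSets hf isClosed_Ici))

theorem exists_isZeroPartition_oscillation_le (f : Z →ᵇ ℝ) {δ : ℝ} (hδ : 0 < δ) :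
    ∃ (s : Finset ℤ) (A : s → zeroAlgebra Z), IsZeroPartition A ∧
      ∀ k, ∀ z ∈ (A k : Set Z), k * δ ≤ f z ∧ f z ≤ (k + 1) * δ := by
  refine ⟨Finset.Icc ⌊-‖f‖ / δ⌋ ⌊‖f‖ / δ⌋,
    fun k => ⟨_, setOf_floor_eq_mem_zeroAlgebra (f := fun z => f z / δ) (by fun_prop) k⟩,
    ⟨fun i j hij => ?_, eq_univ_of_forall fun z => ?_⟩, fun k z hz => ?_⟩
  · exact disjoint_left.2 fun z hi hj => hij (Subtype.ext (hi.symm.trans hj))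
  · have hz := abs_le.1 (f.norm_coe_le_norm z)
    refine mem_iUnion.2 ⟨⟨⌊f z / δ⌋, Finset.mem_Icc.2 ⟨?_, ?_⟩⟩, rfl⟩
    · exact Int.floor_le_floor (div_le_div_of_nonneg_right hz.1 hδ.le)
    · exact Int.floor_le_floor (div_le_div_of_nonneg_right hz.2 hδ.le)
  · obtain ⟨hle, hlt⟩ := Int.floor_eq_iff.1 hz
    exact ⟨(le_div_iff₀ hδ).1 hle, ((div_lt_iff₀ hδ).1 hlt).le⟩

theorem IsProbabilityCharge.chargeIntegral_add_chargeIntegral_neg_nonneg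
    (hm : IsProbabilityCharge m) (f : Z →ᵇ ℝ) :
    0 ≤ chargeIntegral m f + chargeIntegral m (-f) := by
  refine le_of_forall_pos_le_add fun δ hδ => ?_
  obtain ⟨s, A, hA, h⟩ := exists_isZeroPartition_oscillation_le f hδ
  have hf := hm.le_chargeIntegral (sum_mem_lowerSums hA fun k z hz => (h k z hz).1)
  have hneg := hm.le_chargeIntegral (f := -f)
    (sum_mem_lowerSums hA fun k z hz => neg_le_neg (h k z hz).2)
  have hsum : ∑ k : s, (k : ℝ) * δ * m (A k) + ∑ k : s, -((k + 1 : ℝ) * δ) * m (A k) = -δ :=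
    calc _ = ∑ k, -δ * m (A k) := by
          rw [← Finset.sum_add_distrib]
          exact Finset.sum_congr rfl fun k _ => by ring
      _ = -δ := by rw [← Finset.mul_sum, hm.sum_eq_one hA, mul_one]
  linarith

end Charges

section Means

variable {Z : Type*} [TopologicalSpace Z]

/-- Means on `C_b(Z)`: additive functionals bounded by the supremum. These are exactly the positive
linear functionals `I` with `I 1 = 1`. -/
structure IsMean (I : (Z →ᵇ ℝ) → ℝ) : Prop where
  map_add : ∀ f g, I (f + g) = I f + I g
  le_of_forall_le : ∀ (f : Z →ᵇ ℝ) (b : ℝ), (∀ z, f z ≤ b) → I f ≤ b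

namespace IsMean

variable {I : (Z →ᵇ ℝ) → ℝ}

theorem map_sub (hI : IsMean I) (f g : Z →ᵇ ℝ) : I (f - g) = I f - I g :=
  (AddMonoidHom.mk' I hI.map_add).map_sub f g

theorem map_neg (hI : IsMean I) (f : Z →ᵇ ℝ) : I (-f) = -I f :=
  (AddMonoidHom.mk' I hI.map_add).map_neg f

theorem mono (hI : IsMean I) {f g : Z →ᵇ ℝ} (h : ∀ z, f z ≤ g z) : I f ≤ I g := by
  have := hI.le_of_forall_le (f - g) 0 fun z => sub_nonpos.2 (h z)
  rwa [hI.map_sub, sub_nonpos] at this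

theorem le_of_forall_ge (hI : IsMean I) {f : Z →ᵇ ℝ} {a : ℝ} (ha : ∀ z, a ≤ f z) : a ≤ I f := by
  have := hI.le_of_forall_le (-f) (-a) fun z => neg_le_neg (ha z)
  rwa [hI.map_neg, neg_le_neg_iff] at this

theorem map_const (hI : IsMean I) (t : ℝ) : I (const Z t) = t :=
  le_antisymm (hI.le_of_forall_le _ _ fun _ => le_rfl) (hI.le_of_forall_ge fun _ => le_rfl)

theorem abs_le_norm (hI : IsMean I) (f : Z →ᵇ ℝ) : |I f| ≤ ‖f‖ :=
  abs_le.2 ⟨hI.le_of_forall_ge fun z => (abs_le.1 (f.norm_coe_le_norm z)).1,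
    hI.le_of_forall_le _ _ fun z => (abs_le.1 (f.norm_coe_le_norm z)).2⟩

theorem map_smul (hI : IsMean I) (t : ℝ) (f : Z →ᵇ ℝ) : I (t • f) = t * I f := by
  let φ := AddMonoidHom.mk' I hI.map_add
  have hφ : Continuous φ := AddMonoidHomClass.continuous_of_bound φ 1 fun f =>
    (hI.abs_le_norm f).trans_eq (one_mul _).symm
  exact map_real_smul φ hφ t f

end IsMean

theorem IsProbabilityCharge.isMean_chargeIntegral {m : zeroAlgebra Z → ℝ}
    (hm : IsProbabilityCharge m) : IsMean (chargeIntegral m) where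
  map_add f g := by
    have hfg := hm.add_le_chargeIntegral_add (f + g) (-g)
    have hg := hm.chargeIntegral_add_chargeIntegral_neg_nonneg g
    rw [add_neg_cancel_right] at hfg
    exact le_antisymm (by linarith) (hm.add_le_chargeIntegral_add f g)
  le_of_forall_le _ _ := hm.chargeIntegral_le

end Means

section Uniqueness

variable {Z : Type*} [TopologicalSpace Z] {m n : zeroAlgebra Z → ℝ}

namespace IsProbabilityCharge

theorem apply_le_chargeIntegral (hm : IsProbabilityCharge m) {A : zeroAlgebra Z} {f : Z →ᵇ ℝ}
    (h0 : ∀ z, 0 ≤ f z) (h1 : ∀ z ∈ (A : Set Z), 1 ≤ f z) : m A ≤ chargeIntegral m f := by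
  have h := sum_mem_lowerSums (m := m) (f := f) (isZeroPartition_cond A)
    (a := fun b => cond b 1 0) fun b z hz => by
      cases b
      · exact h0 z
      · exact h1 z hz
  simp only [Fintype.sum_bool, cond_true, cond_false, one_mul, zero_mul, add_zero] at h
  exact hm.le_chargeIntegral h

theorem chargeIntegral_le_apply (hm : IsProbabilityCharge m) {A : zeroAlgebra Z} {f : Z →ᵇ ℝ}
    (h1 : ∀ z, f z ≤ 1) (h0 : ∀ z ∉ (A : Set Z), f z ≤ 0) : chargeIntegral m f ≤ m A := by
  have h : m Aᶜ ≤ chargeIntegral m (const Z 1 - f) := hm.apply_le_chargeIntegral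
    (fun z => by simpa using h1 z) fun z hz => by simpa using h0 z hz
  rw [hm.apply_compl, hm.isMean_chargeIntegral.map_sub, hm.isMean_chargeIntegral.map_const] at h
  linarith

end IsProbabilityCharge

theorem exists_chargeIntegral_le_apply_add (hn : n ∈ unitCharges Z) {F : zeroAlgebra Z}
    (hF : (F : Set Z) ∈ zeroSets Z) {ε : ℝ} (hε : 0 < ε) :
    ∃ f : Z →ᵇ ℝ, (∀ z, 0 ≤ f z) ∧ (∀ z ∈ (F : Set Z), 1 ≤ f z) ∧
      chargeIntegral n f ≤ n F + ε := by
  have hn' := isProbabilityCharge_of_mem_unitCharges hn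
  obtain ⟨G₀, hG₀, hGF, hGε⟩ := hn.1.regular Fᶜ ε hε
  let G : zeroAlgebra Z := ⟨G₀, mem_zeroAlgebra_of_mem_zeroSets hG₀⟩
  obtain ⟨f, hfF, hfG, hf⟩ := exists_boundedContinuous_of_disjoint_zeroSets hF hG₀
    (subset_compl_iff_disjoint_left.1 hGF)
  refine ⟨f, fun z => (hf z).1, fun z hz => (hfF hz).ge, ?_⟩
  have hfGc : chargeIntegral n f ≤ n Gᶜ := hn'.chargeIntegral_le_apply (fun z => (hf z).2)
    fun z hz => (hfG (notMem_compl_iff.1 hz)).le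
  have hGc : n Fᶜ = n G + n (Fᶜ \ G) := hn'.apply_eq_apply_add_apply_sdiff hGF
  have hsmall := (abs_lt.1 (hGε (Fᶜ \ G) Subset.rfl)).2
  rw [hn'.apply_compl] at hfGc hGc
  linarith

theorem eq_of_forall_zeroSet_apply_le (hm : m ∈ unitCharges Z) (hn : IsProbabilityCharge n)
    (h : ∀ F : zeroAlgebra Z, (F : Set Z) ∈ zeroSets Z → m F ≤ n F) : m = n := by
  have hm' := isProbabilityCharge_of_mem_unitCharges hm
  have hle : ∀ A, m A ≤ n A := fun A => by
    refine le_of_forall_pos_le_add fun ε hε => ?_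
    obtain ⟨F₀, hF₀, hFA, hFε⟩ := hm.1.regular A ε hε
    let F : zeroAlgebra Z := ⟨F₀, mem_zeroAlgebra_of_mem_zeroSets hF₀⟩
    calc m A = m F + m (A \ F) := hm'.apply_eq_apply_add_apply_sdiff hFA
      _ ≤ n A + ε := add_le_add ((h F hF₀).trans (hn.mono hFA))
        (abs_lt.1 (hFε (A \ F) Subset.rfl)).2.le
  funext A
  have hc := hle Aᶜ
  rw [hm'.apply_compl, hn.apply_compl] at hc
  exact le_antisymm (hle A) (by linarith)

theorem unitCharges_ext (hm : m ∈ unitCharges Z) (hn : n ∈ unitCharges Z)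
    (h : ∀ f, chargeIntegral m f = chargeIntegral n f) : m = n := by
  refine eq_of_forall_zeroSet_apply_le hm (isProbabilityCharge_of_mem_unitCharges hn)
    fun F hF => le_of_forall_pos_le_add fun ε hε => ?_
  obtain ⟨f, hf0, hf1, hfε⟩ := exists_chargeIntegral_le_apply_add hn hF hε
  calc m F ≤ chargeIntegral m f :=
      (isProbabilityCharge_of_mem_unitCharges hm).apply_le_chargeIntegral hf0 hf1
    _ = chargeIntegral n f := h f
    _ ≤ n F + ε := hfε

end Uniqueness

section MeasureCharge

variable {Z : Type*} [TopologicalSpace Z] [MeasurableSpace Z] [BorelSpace Z]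

theorem measurableSet_of_mem_zeroAlgebra {A : Set Z} (hA : A ∈ zeroAlgebra Z) :
    MeasurableSet A := by
  induction hA with
  | base A hA => exact (isClosed_of_mem_zeroSets hA).measurableSet
  | empty => exact .empty
  | compl A _ ih => exact ih.compl
  | union A B _ _ ihA ihB => exact ihA.union ihB

theorem exists_cozeroSet_superset_measure_sdiff_lt (γ : Measure Z) [IsFiniteMeasure γ] {A : Set Z}
    (hA : A ∈ zeroSets Z) {ε : ENNReal} (hε : 0 < ε) :
    ∃ G ∈ zeroSets Z, A ⊆ Gᶜ ∧ γ (Gᶜ \ A) < ε := by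
  obtain ⟨f, rfl⟩ := hA
  obtain ⟨V, hV, hVo, -, hVε⟩ := (measurableSet_singleton (0 : ℝ)).exists_isOpen_sdiff_lt
    (μ := γ.map f) (measure_ne_top _ _) hε.ne'
  refine ⟨f ⁻¹' Vᶜ, preimage_mem_zeroSets f.continuous hVo.isClosed_compl, ?_, ?_⟩
  · rw [← preimage_compl, compl_compl]
    exact preimage_mono hV
  · rwa [Measure.map_apply f.continuous.measurable
      (hVo.measurableSet.diff (measurableSet_singleton 0)), preimage_sdiff,
      ← compl_compl (f ⁻¹' V), ← preimage_compl] at hVε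

theorem exists_zeroSet_cozeroSet_approx (γ : Measure Z) [IsFiniteMeasure γ] {A : Set Z}
    (hA : A ∈ zeroAlgebra Z) {ε : ENNReal} (hε : 0 < ε) :
    ∃ F ∈ zeroSets Z, ∃ G ∈ zeroSets Z, F ⊆ A ∧ A ⊆ Gᶜ ∧ γ (Gᶜ \ F) < ε := by
  induction hA generalizing ε with
  | base A hA =>
    obtain ⟨G, hG, hAG, h⟩ := exists_cozeroSet_superset_measure_sdiff_lt γ hA hε
    exact ⟨A, hA, G, hG, Subset.rfl, hAG, h⟩
  | empty => exact ⟨∅, empty_mem_zeroSets, univ, univ_mem_zeroSets, Subset.rfl, by simp, by simpa⟩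
  | compl A _ ih =>
    obtain ⟨F, hF, G, hG, hFA, hAG, h⟩ := ih hε
    refine ⟨G, hG, F, hF, subset_compl_comm.1 hAG, compl_subset_compl.2 hFA, ?_⟩
    rwa [Set.sdiff_eq, inter_comm, ← Set.sdiff_eq]
  | union A B _ _ ihA ihB =>
    obtain ⟨F, hF, G, hG, hFA, hAG, h⟩ := ihA (ENNReal.half_pos hε.ne')
    obtain ⟨F', hF', G', hG', hFB, hBG, h'⟩ := ihB (ENNReal.half_pos hε.ne')
    refine ⟨F ∪ F', union_mem_zeroSets hF hF', G ∩ G', inter_mem_zeroSets hG hG',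
      union_subset_union hFA hFB, ?_, ?_⟩
    · rw [compl_inter]
      exact union_subset_union hAG hBG
    · calc γ ((G ∩ G')ᶜ \ (F ∪ F')) ≤ γ ((Gᶜ \ F) ∪ (G'ᶜ \ F')) := by
            rw [compl_inter]
            refine measure_mono ?_
            rintro z ⟨hz | hz, hn⟩
            exacts [.inl ⟨hz, fun h => hn (.inl h)⟩, .inr ⟨hz, fun h => hn (.inr h)⟩]
        _ ≤ γ (Gᶜ \ F) + γ (G'ᶜ \ F') := measure_union_le _ _
        _ < ε / 2 + ε / 2 := ENNReal.add_lt_add h h'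
        _ = ε := ENNReal.add_halves ε

theorem measureReal_mem_unitCharges (γ : Measure Z) [IsProbabilityMeasure γ] :
    (fun A : zeroAlgebra Z => γ.real A) ∈ unitCharges Z := by
  refine ⟨⟨fun A B C hAB hC => ?_, ⟨1, fun A => ?_⟩, fun A ε hε => ?_⟩,
    fun A => measureReal_nonneg, by simp⟩
  · rw [hC, measureReal_union hAB (measurableSet_of_mem_zeroAlgebra B.2)]
  · rw [abs_of_nonneg measureReal_nonneg]
    exact measureReal_le_one
  · obtain ⟨F, hF, G, -, hFA, hAG, h⟩ :=
      exists_zeroSet_cozeroSet_approx γ A.2 (ENNReal.ofReal_pos.2 hε)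
    refine ⟨F, hF, hFA, fun B hB => ?_⟩
    rw [abs_of_nonneg measureReal_nonneg]
    exact (ENNReal.lt_ofReal_iff_toReal_lt (measure_ne_top _ _)).1
      ((measure_mono (hB.trans (sdiff_subset_sdiff_left hAG))).trans_lt h)

theorem chargeIntegral_measureReal (γ : Measure Z) [IsProbabilityMeasure γ] (f : Z →ᵇ ℝ) :
    chargeIntegral (fun A : zeroAlgebra Z => γ.real A) f = ∫ z, f z ∂γ := by
  have hm := isProbabilityCharge_of_mem_unitCharges (measureReal_mem_unitCharges γ)
  have hle : ∀ f : Z →ᵇ ℝ, chargeIntegral (fun A : zeroAlgebra Z => γ.real A) f ≤ ∫ z, f z ∂γ :=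
    fun f => by
      refine csSup_le (hm.nonempty_lowerSums f) ?_
      rintro _ ⟨n, A, a, hd, hu, ha, rfl⟩
      have hA := fun i => measurableSet_of_mem_zeroAlgebra (A i).2
      rw [← setIntegral_univ, ← hu, integral_iUnion_fintype hA hd fun i =>
        (f.integrable γ).integrableOn]
      refine Finset.sum_le_sum fun i _ => ?_
      rw [mul_comm]
      exact setIntegral_ge_of_const_le (hA i) (measure_ne_top _ _) (ha i)
        (f.integrable γ).integrableOn
  refine le_antisymm (hle f) ?_
  have h := hle (-f)
  rwa [hm.isMean_chargeIntegral.map_neg, coe_neg, funext (Pi.neg_apply f), integral_neg,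
    neg_le_neg_iff] at h

theorem isMean_integral (γ : Measure Z) [IsProbabilityMeasure γ] :
    IsMean fun f : Z →ᵇ ℝ => ∫ z, f z ∂γ := by
  simp only [← chargeIntegral_measureReal γ]
  exact (isProbabilityCharge_of_mem_unitCharges
    (measureReal_mem_unitCharges γ)).isMean_chargeIntegral

end MeasureCharge

section Radon

variable {Z W : Type*} [TopologicalSpace Z] [TopologicalSpace W]

theorem IsRadonProbability.innerRegularCompactLTTop [MeasurableSpace Z] {γ : Measure Z}
    (hγ : IsRadonProbability γ) : γ.InnerRegularCompactLTTop where
  innerRegular := by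
    have := hγ.1
    rintro B ⟨hB, -⟩ r hr
    obtain ⟨K, hK, hKB, h⟩ := hγ.2 B hB (γ B - r) (tsub_pos_of_lt hr)
    refine ⟨K, hKB, hK, lt_of_not_ge fun hle => lt_irrefl (γ B) ?_⟩
    calc γ B ≤ γ (B \ K ∪ K) := measure_mono (subset_sdiff_union _ _)
      _ ≤ γ (B \ K) + γ K := measure_union_le _ _
      _ < (γ B - r) + r := ENNReal.add_lt_add_of_lt_of_le (measure_ne_top _ _) h hle
      _ = γ B := tsub_add_cancel_of_le hr.le

theorem exists_boundedContinuous_one_zero_of_isCompact_subset_isOpen [T35Space Z] {K U : Set Z}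
    (hK : IsCompact K) (hU : IsOpen U) (hKU : K ⊆ U) :
    ∃ f : Z →ᵇ ℝ, EqOn f 1 K ∧ EqOn f 0 Uᶜ ∧ ∀ z, f z ∈ Icc (0 : ℝ) 1 := by
  obtain ⟨V, hV, rfl⟩ := isEmbedding_stoneCechUnit.isInducing.isOpen_iff.1 hU
  obtain ⟨g, hg0, hg1, hg⟩ := exists_continuous_zero_one_of_isClosed hV.isClosed_compl
    (hK.image continuous_stoneCechUnit).isClosed
    (disjoint_left.2 (by rintro _ hz ⟨z, hzK, rfl⟩; exact hz (hKU hzK)))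
  exact ⟨(mkOfCompact g).compContinuous ⟨stoneCechUnit, continuous_stoneCechUnit⟩,
    fun z hz => hg1 (mem_image_of_mem _ hz), fun z hz => hg0 hz, fun z => hg _⟩

theorem exists_boundedContinuous_zero_one_of_isCompact_subset_isOpen [T35Space Z] {K U : Set Z}
    (hK : IsCompact K) (hU : IsOpen U) (hKU : K ⊆ U) :
    ∃ f : Z →ᵇ ℝ, EqOn f 0 K ∧ EqOn f 1 Uᶜ ∧ ∀ z, f z ∈ Icc (0 : ℝ) 1 := by
  obtain ⟨f, hfK, hfU, hf⟩ :=
    exists_boundedContinuous_one_zero_of_isCompact_subset_isOpen hK hU hKU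
  exact ⟨1 - f, fun z hz => by simp [hfK hz], fun z hz => by simp [hfU hz],
    fun z => ⟨sub_nonneg.2 (hf z).2, sub_le_self 1 (hf z).1⟩⟩

variable [MeasurableSpace Z] [BorelSpace Z] [MeasurableSpace W] [BorelSpace W]

theorem exists_measurableSet_preimage_eq {ι : Z → W} (hι : Topology.IsInducing ι) {B : Set Z}
    (hB : MeasurableSet B) : ∃ C, MeasurableSet C ∧ ι ⁻¹' C = B := by
  borelize Z W
  rw [hι.eq_induced, borel_comap] at hB
  exact hB

theorem measure_ext_of_integral_eq [T35Space Z] {γ η : Measure Z} [IsFiniteMeasure γ]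
    [IsFiniteMeasure η] [γ.InnerRegularCompactLTTop] [η.InnerRegularCompactLTTop]
    (h : ∀ f : Z →ᵇ ℝ, ∫ z, f z ∂γ = ∫ z, f z ∂η) : γ = η := by
  borelize (StoneCech Z)
  have hι : Continuous (stoneCechUnit : Z → StoneCech Z) := continuous_stoneCechUnit
  have hγ := Measure.InnerRegularCompactLTTop.map_of_continuous (μ := γ) hι
  have hη := Measure.InnerRegularCompactLTTop.map_of_continuous (μ := η) hι
  have hmap : γ.map stoneCechUnit = η.map (stoneCechUnit : Z → StoneCech Z) :=
    Measure.ext_of_integral_eq_on_compactlySupported fun g => by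
      rw [integral_map hι.aemeasurable (by fun_prop), integral_map hι.aemeasurable (by fun_prop)]
      exact h ((mkOfCompact (g : C(StoneCech Z, ℝ))).compContinuous ⟨_, hι⟩)
  ext B hB
  obtain ⟨C, hC, rfl⟩ :=
    exists_measurableSet_preimage_eq (isEmbedding_stoneCechUnit (X := Z)).isInducing hB
  rw [← Measure.map_apply hι.measurable hC, hmap, Measure.map_apply hι.measurable hC]

theorem map_comap_of_measure_compl_range_eq_zero {ι : Z → W} (hι : Topology.IsEmbedding ι)
    {η : Measure W} (hη : η (range ι)ᶜ = 0) : (η.comap ι).map ι = η := by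
  have hrange : NullMeasurableSet (range ι) η :=
    (NullMeasurableSet.of_null hη).of_compl
  have himage : ∀ B, MeasurableSet B → NullMeasurableSet (ι '' B) η := fun B hB => by
    obtain ⟨C, hC, rfl⟩ := exists_measurableSet_preimage_eq hι.isInducing hB
    rw [image_preimage_eq_inter_range]
    exact hC.nullMeasurableSet.inter hrange
  ext C hC
  rw [Measure.map_apply hι.continuous.measurable hC, Measure.comap_apply₀ ι η hι.injective himage
    (hι.continuous.measurable hC).nullMeasurableSet, image_preimage_eq_inter_range]
  exact measure_inter_conull hη

theorem isRadonProbability_of_map [T2Space W] {ι : Z → W} (hι : Topology.IsEmbedding ι)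
    {γ : Measure Z} [IsProbabilityMeasure γ] [(γ.map ι).InnerRegularCompactLTTop]
    (ht : ∀ ε : ENNReal, 0 < ε → ∃ K : Set Z, IsCompact K ∧ γ.map ι (ι '' K)ᶜ < ε) :
    IsRadonProbability γ := by
  refine ⟨‹_›, fun B hB ε hε => ?_⟩
  have hιm := hι.continuous.measurable
  obtain ⟨C, hC, rfl⟩ := exists_measurableSet_preimage_eq hι.isInducing hB
  obtain ⟨L, hLC, hL, hLε⟩ := hC.exists_isCompact_sdiff_lt (μ := γ.map ι) (measure_ne_top _ _)
    (ENNReal.half_pos hε.ne').ne'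
  obtain ⟨K, hK, hKε⟩ := ht (ε / 2) (ENNReal.half_pos hε.ne')
  refine ⟨K ∩ ι ⁻¹' L, hK.inter_right (hL.isClosed.preimage hι.continuous),
    inter_subset_right.trans (preimage_mono hLC), ?_⟩
  calc γ (ι ⁻¹' C \ (K ∩ ι ⁻¹' L)) ≤ γ (ι ⁻¹' (C \ L ∪ (ι '' K)ᶜ)) := by
        refine measure_mono fun z ⟨hzC, hz⟩ => or_iff_not_imp_right.2 fun hzK =>
          ⟨hzC, fun hzL => ?_⟩
        exact hz ⟨hι.injective.mem_set_image.1 (not_not.1 hzK), hzL⟩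
    _ = γ.map ι (C \ L ∪ (ι '' K)ᶜ) := by
        rw [Measure.map_apply hιm ((hC.diff hL.measurableSet).union
          (hK.image hι.continuous).measurableSet.compl)]
    _ ≤ γ.map ι (C \ L) + γ.map ι (ι '' K)ᶜ := measure_union_le _ _
    _ < ε / 2 + ε / 2 := ENNReal.add_lt_add hLε hKε
    _ = ε := ENNReal.add_halves ε

theorem exists_isRadonProbability_map_eq [T2Space W] {ι : Z → W} (hι : Topology.IsEmbedding ι)
    {η : Measure W} [IsProbabilityMeasure η] [η.InnerRegularCompactLTTop]
    (ht : ∀ ε : ENNReal, 0 < ε → ∃ K : Set Z, IsCompact K ∧ η (ι '' K)ᶜ < ε) :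
    ∃ γ : Measure Z, IsRadonProbability γ ∧ γ.map ι = η := by
  have hrange : η (range ι)ᶜ = 0 := by
    by_contra hne
    obtain ⟨K, -, hK⟩ := ht _ (pos_iff_ne_zero.2 hne)
    exact hK.not_ge (measure_mono (compl_subset_compl.2 (image_subset_range ι K)))
  have hmap := map_comap_of_measure_compl_range_eq_zero hι hrange
  have hprob : IsProbabilityMeasure (η.comap ι) := ⟨by
    rw [← preimage_univ (f := ι), ← Measure.map_apply hι.continuous.measurable .univ, hmap,
      measure_univ]⟩
  have hreg : ((η.comap ι).map ι).InnerRegularCompactLTTop := by rwa [hmap]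
  exact ⟨η.comap ι, isRadonProbability_of_map hι (by rwa [hmap]), hmap⟩

end Radon

section Riesz

variable {Z : Type*} [TopologicalSpace Z] {I : (Z →ᵇ ℝ) → ℝ}

/-- Tight functionals on `C_b(Z)`: those that are small on the functions with values in `[0, 1]`
vanishing on a suitable compact set. For means this is the condition for being the integral of a
Radon measure. -/
def IsTight (I : (Z →ᵇ ℝ) → ℝ) : Prop :=
  ∀ ε : ℝ, 0 < ε → ∃ K : Set Z, IsCompact K ∧
    ∀ f : Z →ᵇ ℝ, (∀ z, f z ∈ Icc (0 : ℝ) 1) → EqOn f 0 K → I f ≤ ε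

/-- The restriction to `Z` of a continuous function on the Stone–Čech compactification `βZ`. -/
noncomputable def restrictStoneCech (g : C(StoneCech Z, ℝ)) : Z →ᵇ ℝ :=
  (mkOfCompact g).compContinuous ⟨stoneCechUnit, continuous_stoneCechUnit⟩

theorem surjective_restrictStoneCech : Function.Surjective (restrictStoneCech (Z := Z)) := by
  intro f
  have hf : ∀ z, f z ∈ Icc (-‖f‖) ‖f‖ := fun z => abs_le.1 (f.norm_coe_le_norm z)
  have hc : Continuous fun z => (⟨f z, hf z⟩ : Icc (-‖f‖) ‖f‖) := by fun_prop
  refine ⟨⟨fun p => ((stoneCechExtend hc p : Icc (-‖f‖) ‖f‖) : ℝ),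
    continuous_subtype_val.comp (continuous_stoneCechExtend hc)⟩, ?_⟩
  ext z
  exact congrArg Subtype.val (stoneCechExtend_stoneCechUnit hc z)

/-- The positive functional on `C(βZ)` induced by a mean on `C_b(Z)`. -/
noncomputable def IsMean.stoneCechFunctional (hI : IsMean I) :
    CompactlySupportedContinuousMap (StoneCech Z) ℝ →ₚ[ℝ] ℝ :=
  PositiveLinearMap.mk₀
    { toFun := fun g => I (restrictStoneCech (g : C(StoneCech Z, ℝ)))
      map_add' := fun f g => by rw [← hI.map_add]; rfl
      map_smul' := fun t g => by rw [RingHom.id_apply, smul_eq_mul, ← hI.map_smul]; rfl }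
    fun _ hg => hI.le_of_forall_ge fun z => hg (stoneCechUnit z)

theorem IsMean.exists_measure_stoneCech (hI : IsMean I) [MeasurableSpace (StoneCech Z)]
    [BorelSpace (StoneCech Z)] :
    ∃ η : Measure (StoneCech Z), IsProbabilityMeasure η ∧ η.Regular ∧
      ∀ g : C(StoneCech Z, ℝ), ∫ p, g p ∂η = I (restrictStoneCech g) := by
  let η := RealRMK.rieszMeasure hI.stoneCechFunctional
  have hη : ∀ g : C(StoneCech Z, ℝ), ∫ p, g p ∂η = I (restrictStoneCech g) := fun g =>
    RealRMK.integral_rieszMeasure hI.stoneCechFunctional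
      (CompactlySupportedContinuousMap.continuousMapEquiv g)
  refine ⟨η, ⟨?_⟩, inferInstance, hη⟩
  have hone : η.real univ = 1 := by
    simpa using (hη 1).trans (hI.map_const 1)
  exact (ENNReal.toReal_eq_one_iff _).1 hone

theorem measure_compl_le_of_forall_integral_le {W : Type*} [TopologicalSpace W] [T4Space W]
    [MeasurableSpace W] [BorelSpace W] {η : Measure W} [IsFiniteMeasure η] [η.Regular]
    {F : Set W} (hF : IsClosed F) {ε : ℝ}
    (h : ∀ g : W →ᵇ ℝ, (∀ p, g p ∈ Icc (0 : ℝ) 1) → EqOn g 0 F → ∫ p, g p ∂η ≤ ε) :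
    η Fᶜ ≤ ENNReal.ofReal ε := by
  rw [hF.isOpen_compl.measure_eq_iSup_isCompact]
  refine iSup₂_le fun L hLF => iSup_le fun hL => ?_
  obtain ⟨g, hg0, hg1, hg⟩ := exists_continuous_zero_one_of_isClosed hF hL.isClosed
    (disjoint_left.2 fun p hp hpL => hLF hpL hp)
  let g' : W →ᵇ ℝ := .ofNormedAddCommGroup g g.continuous 1 fun p => by
    rw [Real.norm_eq_abs, abs_of_nonneg (hg p).1]
    exact (hg p).2
  refine (ENNReal.le_ofReal_iff_toReal_le (measure_ne_top _ _)
    ((integral_nonneg fun p => (hg p).1).trans (h g' hg hg0))).2 ?_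
  calc η.real L ≤ η.real {p | 1 ≤ g' p} := measureReal_mono fun p hp => (hg1 hp).ge
    _ ≤ ∫ p, g' p ∂η := by
      rw [← one_mul (η.real _)]
      exact mul_meas_ge_le_integral_of_nonneg (.of_forall fun p => (hg p).1) (g'.integrable η) 1
    _ ≤ ε := h g' hg hg0

theorem IsMean.exists_isRadonProbability [T35Space Z] [MeasurableSpace Z] [BorelSpace Z]
    (hI : IsMean I) (ht : IsTight I) :
    ∃ γ : Measure Z, IsRadonProbability γ ∧ ∀ f : Z →ᵇ ℝ, ∫ z, f z ∂γ = I f := by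
  borelize (StoneCech Z)
  obtain ⟨η, hη, hreg, hint⟩ := hI.exists_measure_stoneCech
  have hι : Topology.IsEmbedding (stoneCechUnit : Z → StoneCech Z) := isEmbedding_stoneCechUnit
  have hηt : ∀ ε : ENNReal, 0 < ε → ∃ K : Set Z, IsCompact K ∧ η (stoneCechUnit '' K)ᶜ < ε := by
    intro ε hε
    obtain ⟨δ, hδ, hδε⟩ := ENNReal.lt_iff_exists_nnreal_btwn.1 hε
    obtain ⟨K, hK, hIK⟩ := ht δ (by exact_mod_cast hδ)
    refine ⟨K, hK, (measure_compl_le_of_forall_integral_le (hK.image hι.continuous).isClosed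
      fun g hg hgK => ?_).trans_lt ((ENNReal.ofReal_coe_nnreal (p := δ)).trans_lt hδε)⟩
    exact (hint g).trans_le (hIK _ (fun z => hg _) fun z hz => hgK (mem_image_of_mem _ hz))
  obtain ⟨γ, hγ, rfl⟩ := exists_isRadonProbability_map_eq hι hηt
  refine ⟨γ, hγ, fun f => ?_⟩
  obtain ⟨g, rfl⟩ := surjective_restrictStoneCech f
  rw [← hint g, integral_map hι.continuous.aemeasurable
    g.continuous.measurable.aestronglyMeasurable]
  rfl

end Riesz

section ExtendedReals

theorem sub_coe_eq_sub_coe_of_add_eq_add {x y : EReal} {s t : ℝ} (h : x + t = y + s) :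
    x - s = y - t := by
  calc x - s = x + t - t - s := by rw [EReal.add_sub_cancel_right]
    _ = y + s - s - t := by rw [h]; simp only [sub_eq_add_neg, add_right_comm]
    _ = y - t := by rw [EReal.add_sub_cancel_right]

theorem toENNReal_neg_le_ofReal {x : EReal} {M : ℝ} (hx : -(M : EReal) ≤ x) :
    (-x).toENNReal ≤ ENNReal.ofReal M := by
  rw [← EReal.real_coe_toENNReal]
  exact EReal.toENNReal_le_toENNReal (EReal.neg_le_of_neg_le hx)

theorem toENNReal_add_coe_add_toENNReal_neg {x : EReal} {M : ℝ} (hM : 0 ≤ M)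
    (hx : -(M : EReal) ≤ x) :
    (x + M).toENNReal + (-x).toENNReal = x.toENNReal + ENNReal.ofReal M := by
  induction x with
  | bot => exact absurd hx (not_le.2 (EReal.bot_lt_coe (-M)))
  | top => simp
  | coe x =>
    have hxM : 0 ≤ x + M := by
      have : -M ≤ x := EReal.coe_le_coe_iff.1 hx
      linarith
    rw [← EReal.coe_add, ← EReal.coe_neg]
    simp only [EReal.real_coe_toENNReal]
    rcases le_total 0 x with h0 | h0
    · rw [ENNReal.ofReal_of_nonpos (neg_nonpos.2 h0), add_zero, ENNReal.ofReal_add h0 hM]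
    · rw [ENNReal.ofReal_of_nonpos h0, zero_add, ← ENNReal.ofReal_add hxM (neg_nonneg.2 h0),
        add_neg_cancel_comm]

theorem coe_max_zero_sub_le {x : EReal} {s M : ℝ} (hx : -(M : EReal) ≤ x)
    (hs : ENNReal.ofReal s ≤ (x + M).toENNReal) : ((max s 0 - M : ℝ) : EReal) ≤ x := by
  have hxM : 0 ≤ x + M := by
    rwa [← EReal.sub_le_iff_le_add (.inl (EReal.coe_ne_bot M)) (.inl (EReal.coe_ne_top M)),
      zero_sub]
  rw [EReal.coe_sub, EReal.sub_le_iff_le_add (.inl (EReal.coe_ne_bot M))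
    (.inl (EReal.coe_ne_top M)), ← EReal.coe_ennreal_ofReal, ← EReal.coe_toENNReal hxM]
  exact EReal.coe_ennreal_le_coe_ennreal_iff.2 hs

theorem continuous_add_coe (M : ℝ) : Continuous fun x : EReal => x + M :=
  continuous_iff_continuousAt.2 fun x =>
    (EReal.continuousAt_add (p := (x, (M : EReal))) (.inr (EReal.coe_ne_bot M))
      (.inr (EReal.coe_ne_top M))).comp (f := fun x : EReal => (x, (M : EReal)))
      (by fun_prop)

end ExtendedReals

section LowerIntegral

variable {Z : Type*} [MeasurableSpace Z] {γ : Measure Z}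

theorem coe_integral_le_extIntegral {f : Z → ℝ} (hf : Integrable f γ) {c : Z → EReal}
    (hfc : ∀ z, (f z : EReal) ≤ c z) : ((∫ z, f z ∂γ : ℝ) : EReal) ≤ extIntegral γ c := by
  have hneg : ∫⁻ z, ENNReal.ofReal (-f z) ∂γ ≠ ⊤ := hf.neg.lintegral_lt_top.ne
  rw [integral_eq_lintegral_pos_part_sub_lintegral_neg_part hf, EReal.coe_sub,
    EReal.coe_ennreal_toReal hf.lintegral_lt_top.ne, EReal.coe_ennreal_toReal hneg]
  exact EReal.sub_le_sub
    (EReal.coe_ennreal_le_coe_ennreal_iff.2 (lintegral_mono fun z => by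
      simpa only [EReal.real_coe_toENNReal] using EReal.toENNReal_le_toENNReal (hfc z)))
    (EReal.coe_ennreal_le_coe_ennreal_iff.2 (lintegral_mono fun z => by
      simpa only [EReal.real_coe_toENNReal, ← EReal.coe_neg] using
        EReal.toENNReal_le_toENNReal (EReal.neg_le_neg_iff.2 (hfc z))))

theorem extIntegral_eq_lintegral_sub [IsProbabilityMeasure γ] {c : Z → EReal}
    (hc : Measurable c) {M : ℝ} (hM : 0 ≤ M) (hcM : ∀ z, -(M : EReal) ≤ c z) :
    extIntegral γ c = ((∫⁻ z, (c z + M).toENNReal ∂γ : ENNReal) : EReal) - M := by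
  have hneg : Measurable fun z => (-c z).toENNReal := hc.neg.ereal_toENNReal
  have hsum : ∫⁻ z, (c z + M).toENNReal ∂γ + ∫⁻ z, (-c z).toENNReal ∂γ =
      ∫⁻ z, (c z).toENNReal ∂γ + ENNReal.ofReal M := by
    rw [← lintegral_add_right _ hneg,
      lintegral_congr fun z => toENNReal_add_coe_add_toENNReal_neg hM (hcM z),
      lintegral_add_right _ measurable_const, lintegral_const, measure_univ, mul_one]
  have hfin : ∫⁻ z, (-c z).toENNReal ∂γ ≠ ⊤ :=
    ((lintegral_mono fun z => toENNReal_neg_le_ofReal (hcM z)).trans_lt (by simp)).ne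
  have hsum' := congrArg ((↑) : ENNReal → EReal) hsum
  rw [EReal.coe_ennreal_add, EReal.coe_ennreal_add, EReal.coe_ennreal_ofReal, max_eq_left hM,
    ← EReal.coe_ennreal_toReal hfin] at hsum'
  rw [extIntegral, ← EReal.coe_ennreal_toReal hfin]
  exact sub_coe_eq_sub_coe_of_add_eq_add hsum'.symm

variable [TopologicalSpace Z] [BorelSpace Z]

theorem mul_measure_le_iSup_lintegral [T35Space Z] [IsFiniteMeasure γ]
    [γ.InnerRegularCompactLTTop] {h : Z → ENNReal} (hh : LowerSemicontinuous h) {B : Set Z}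
    (hB : MeasurableSet B) {a : ENNReal} (hBh : ∀ z ∈ B, a ≤ h z) :
    a * γ B ≤ ⨆ (f : Z →ᵇ ℝ) (_ : ∀ z, ENNReal.ofReal (f z) ≤ h z),
      ∫⁻ z in B, ENNReal.ofReal (f z) ∂γ := by
  refine ENNReal.mul_le_of_forall_lt fun t hta r hr => ?_
  obtain ⟨K, hKB, hK, hrK⟩ := hB.exists_lt_isCompact_of_ne_top (measure_ne_top γ B) hr
  lift t to NNReal using (hta.trans_le le_top).ne
  obtain ⟨u, huK, huh, hu⟩ := exists_boundedContinuous_one_zero_of_isCompact_subset_isOpen hK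
    (hh.isOpen_preimage t) fun z hz => hta.trans_le (hBh z (hKB hz))
  refine le_iSup₂_of_le ((t : ℝ) • u) (fun z => ?_) ?_
  · by_cases hz : (t : ENNReal) < h z
    · refine le_trans ?_ hz.le
      rw [← ENNReal.ofReal_coe_nnreal]
      exact ENNReal.ofReal_le_ofReal (mul_le_of_le_one_right t.2 (hu z).2)
    · simp [huh hz]
  · calc (t : ENNReal) * r ≤ t * γ K := by gcongr
      _ = ∫⁻ _ in K, t ∂γ := (setLIntegral_const K _).symm
      _ ≤ ∫⁻ z in K, ENNReal.ofReal (((t : ℝ) • u) z) ∂γ :=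
          setLIntegral_mono' hK.measurableSet fun z hz => by simp [huK hz]
      _ ≤ ∫⁻ z in B, ENNReal.ofReal (((t : ℝ) • u) z) ∂γ := lintegral_mono_set hKB

-- Integrating `f` over the support of `φ` alone makes the bound additive in `φ`.
theorem simpleFunc_lintegral_le_iSup_lintegral [T35Space Z] [IsFiniteMeasure γ]
    [γ.InnerRegularCompactLTTop] {h : Z → ENNReal} (hh : LowerSemicontinuous h)
    (φ : SimpleFunc Z ENNReal) (hφ : φ ≤ h) :
    φ.lintegral γ ≤ ⨆ (f : Z →ᵇ ℝ) (_ : ∀ z, ENNReal.ofReal (f z) ≤ h z),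
      ∫⁻ z in Function.support φ, ENNReal.ofReal (f z) ∂γ := by
  induction φ using SimpleFunc.induction with
  | @const a B hB =>
    rw [show SimpleFunc.piecewise B hB (.const Z a) (.const Z 0) = (SimpleFunc.const Z a).restrict B
      by rw [SimpleFunc.restrict, dif_pos hB]; rfl] at hφ ⊢
    rw [SimpleFunc.restrict_const_lintegral a hB, SimpleFunc.coe_restrict _ hB,
      SimpleFunc.coe_const]
    rcases eq_or_ne a 0 with rfl | ha
    · simp
    · have hsupp : Function.support (B.indicator (Function.const Z a)) = B := by
        ext z
        simp [ha]
      rw [hsupp]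
      refine mul_measure_le_iSup_lintegral hh hB fun z hz => ?_
      simpa [SimpleFunc.restrict_apply _ hB, hz] using hφ z
  | @add φ ψ hφψ ihφ ihψ =>
    have hsupp : Function.support (φ + ψ) = Function.support φ ∪ Function.support ψ := by
      ext z
      simp [or_iff_not_imp_left]
    rw [SimpleFunc.add_lintegral]
    refine (add_le_add (ihφ (le_trans le_self_add hφ)) (ihψ (le_trans le_add_self hφ))).trans ?_
    refine ENNReal.biSup_add_biSup_le' ⟨0, by simp⟩ ⟨0, by simp⟩ fun f hf g hg => ?_
    refine le_iSup₂_of_le (f ⊔ g) (fun z => ?_) ?_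
    · exact (ENNReal.ofReal_max _ _).trans_le (max_le (hf z) (hg z))
    · rw [hsupp, lintegral_union ψ.measurableSet_support hφψ]
      gcongr
      · exact le_max_left (f _) (g _)
      · exact le_max_right (f _) (g _)

theorem lintegral_eq_iSup_boundedContinuous [T35Space Z] [IsFiniteMeasure γ]
    [γ.InnerRegularCompactLTTop] {h : Z → ENNReal} (hh : LowerSemicontinuous h) :
    ∫⁻ z, h z ∂γ = ⨆ (f : Z →ᵇ ℝ) (_ : ∀ z, ENNReal.ofReal (f z) ≤ h z),
      ∫⁻ z, ENNReal.ofReal (f z) ∂γ := by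
  refine le_antisymm ?_ (iSup₂_le fun f hf => lintegral_mono hf)
  rw [lintegral]
  exact iSup₂_le fun φ hφ => (simpleFunc_lintegral_le_iSup_lintegral hh φ hφ).trans
    (iSup₂_mono fun f _ => setLIntegral_le_lintegral _ _)

theorem extIntegral_eq_iSup_integral [T35Space Z] [IsProbabilityMeasure γ]
    [γ.InnerRegularCompactLTTop] {c : Z → EReal} (hc : LowerSemicontinuous c)
    (hb : ∃ b : ℝ, ∀ z, (b : EReal) ≤ c z) :
    extIntegral γ c =
      ⨆ (f : Z →ᵇ ℝ) (_ : ∀ z, ((f z : ℝ) : EReal) ≤ c z), ((∫ z, f z ∂γ : ℝ) : EReal) := by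
  obtain ⟨b, hb⟩ := hb
  refine le_antisymm ?_ (iSup₂_le fun f hf => coe_integral_le_extIntegral (f.integrable γ) hf)
  set S := ⨆ (f : Z →ᵇ ℝ) (_ : ∀ z, ((f z : ℝ) : EReal) ≤ c z), ((∫ z, f z ∂γ : ℝ) : EReal)
  let M : ℝ := max (-b) 0
  have hcM : ∀ z, -(M : EReal) ≤ c z := fun z =>
    le_trans (EReal.coe_le_coe_iff.2 (neg_le.1 (le_max_left _ _))) (hb z)
  have hS : ∀ f : Z →ᵇ ℝ, (∀ z, ENNReal.ofReal (f z) ≤ (c z + M).toENNReal) →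
      ((∫ z, (f ⊔ 0) z ∂γ : ℝ) : EReal) ≤ S + M := fun f hf => by
    rw [← EReal.sub_le_iff_le_add (.inl (EReal.coe_ne_bot M)) (.inl (EReal.coe_ne_top M)),
      ← EReal.coe_sub]
    refine le_iSup₂_of_le (f ⊔ 0 + const Z (-M)) (fun z => coe_max_zero_sub_le (hcM z) (hf z)) ?_
    rw [integral_add_const, probReal_univ, one_smul, sub_eq_add_neg]
  have hSM : 0 ≤ S + M := by simpa using hS 0 (by simp)
  have hlsc : LowerSemicontinuous fun z => (c z + M).toENNReal :=
    (EReal.continuous_toENNReal.comp (continuous_add_coe M)).comp_lowerSemicontinuous hc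
      fun x y hxy => EReal.toENNReal_le_toENNReal (add_le_add_left hxy _)
  rw [extIntegral_eq_lintegral_sub hc.measurable (le_max_right _ _) hcM,
    EReal.sub_le_iff_le_add (.inl (EReal.coe_ne_bot M)) (.inl (EReal.coe_ne_top M)),
    lintegral_eq_iSup_boundedContinuous hlsc, ← EReal.coe_toENNReal hSM,
    EReal.coe_ennreal_le_coe_ennreal_iff]
  refine iSup₂_le fun f hf => ?_
  calc ∫⁻ z, ENNReal.ofReal (f z) ∂γ ≤ ∫⁻ z, ENNReal.ofReal ((f ⊔ 0) z) ∂γ :=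
        lintegral_mono fun z => ENNReal.ofReal_le_ofReal (le_max_left (f z) 0)
    _ = ENNReal.ofReal (∫ z, (f ⊔ 0) z ∂γ) :=
        (ofReal_integral_eq_lintegral_ofReal ((f ⊔ 0).integrable γ)
          (.of_forall fun z => le_max_right (f z) 0)).symm
    _ ≤ (S + M).toENNReal := by
        rw [← EReal.real_coe_toENNReal]
        exact EReal.toENNReal_le_toENNReal (hS f hf)

end LowerIntegral

section Marginals

variable {Z W : Type*} [TopologicalSpace Z] [MeasurableSpace Z] [BorelSpace Z]
  [TopologicalSpace W] [MeasurableSpace W] [BorelSpace W]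

theorem IsRadonProbability.map_eq_of_integral_eq [T35Space W] {γ : Measure Z} {μ : Measure W}
    (hγ : IsRadonProbability γ) (hμ : IsRadonProbability μ) {p : Z → W} (hp : Continuous p)
    (h : ∀ φ : W →ᵇ ℝ, ∫ z, φ (p z) ∂γ = ∫ w, φ w ∂μ) : γ.map p = μ := by
  have := hγ.1
  have := hμ.1
  have := hγ.innerRegularCompactLTTop
  have := hμ.innerRegularCompactLTTop
  have := Measure.InnerRegularCompactLTTop.map_of_continuous (μ := γ) hp
  refine measure_ext_of_integral_eq fun φ => ?_
  rw [integral_map hp.aemeasurable (by fun_prop), h]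

theorem IsRadonProbability.isTight_integral [T2Space Z] {μ : Measure Z}
    (hμ : IsRadonProbability μ) : IsTight fun φ : Z →ᵇ ℝ => ∫ z, φ z ∂μ := by
  have := hμ.1
  intro ε hε
  obtain ⟨K, hK, -, hKε⟩ := hμ.2 univ .univ (ENNReal.ofReal ε) (ENNReal.ofReal_pos.2 hε)
  rw [← compl_eq_univ_sdiff] at hKε
  refine ⟨K, hK, fun φ hφ hφK => ?_⟩
  have hKm : MeasurableSet Kᶜ := hK.measurableSet.compl
  calc ∫ z, φ z ∂μ ≤ ∫ z, Kᶜ.indicator 1 z ∂μ :=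
        integral_mono (φ.integrable μ) ((integrable_const (1 : ℝ)).indicator hKm) fun z => by
          by_cases hz : z ∈ K
          · simp [hz, hφK hz]
          · simp [hz, (hφ z).2]
    _ = μ.real Kᶜ := integral_indicator_one hKm
    _ ≤ ε := ((ENNReal.lt_ofReal_iff_toReal_lt (measure_ne_top _ _)).1 hKε).le

end Marginals

section Plans

variable {X Y : Type*} [TopologicalSpace X] [TopologicalSpace Y]

@[simp]
theorem oplus_apply (φ : X →ᵇ ℝ) (ψ : Y →ᵇ ℝ) (z : X × Y) : oplus φ ψ z = φ z.1 + ψ z.2 := rfl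

variable [MeasurableSpace X] [MeasurableSpace Y] {μ : Measure X} {ν : Measure Y}

/-- The means on `C_b(X × Y)` with marginals `μ` and `ν`: the common description of `Γ(μ, ν)` and
`Π(μ, ν)` by functionals. -/
def marginalMeans (μ : Measure X) (ν : Measure Y) : Set (((X × Y) →ᵇ ℝ) → ℝ) :=
  {I | IsMean I ∧ ∀ (φ : X →ᵇ ℝ) (ψ : Y →ᵇ ℝ),
    I (oplus φ ψ) = (∫ x, φ x ∂μ) + ∫ y, ψ y ∂ν}

theorem isClosed_setOf_isMean {Z : Type*} [TopologicalSpace Z] :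
    IsClosed {I : (Z →ᵇ ℝ) → ℝ | IsMean I} := by
  have h : {I : (Z →ᵇ ℝ) → ℝ | IsMean I} = {I | ∀ f g, I (f + g) = I f + I g} ∩
      {I | ∀ (f : Z →ᵇ ℝ) (b : ℝ), (∀ z, f z ≤ b) → I f ≤ b} :=
    Set.ext fun I => ⟨fun hI => ⟨hI.1, hI.2⟩, fun hI => ⟨hI.1, hI.2⟩⟩
  rw [h]
  simp only [ofPred_forall]
  exact .inter
    (isClosed_iInter fun f => isClosed_iInter fun g => isClosed_eq (by fun_prop) (by fun_prop))
    (isClosed_iInter fun f => isClosed_iInter fun b => isClosed_iInter fun _ =>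
      isClosed_le (by fun_prop) continuous_const)

theorem isCompact_marginalMeans (μ : Measure X) (ν : Measure Y) :
    IsCompact (marginalMeans μ ν) := by
  have hbox : IsCompact (univ.pi fun f : (X × Y) →ᵇ ℝ => Icc (-‖f‖) ‖f‖) :=
    isCompact_univ_pi fun f => isCompact_Icc
  have hmarginals : IsClosed {I : ((X × Y) →ᵇ ℝ) → ℝ | ∀ (φ : X →ᵇ ℝ) (ψ : Y →ᵇ ℝ),
      I (oplus φ ψ) = (∫ x, φ x ∂μ) + ∫ y, ψ y ∂ν} := by
    simp only [ofPred_forall]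
    exact isClosed_iInter fun φ => isClosed_iInter fun ψ =>
      isClosed_eq (by fun_prop) continuous_const
  exact hbox.of_isClosed_subset (isClosed_setOf_isMean.inter hmarginals)
    fun I hI f _ => abs_le.1 (hI.1.abs_le_norm f)

theorem isTight_of_mem_marginalMeans [T35Space X] [T35Space Y] [BorelSpace X] [BorelSpace Y]
    (hμ : IsRadonProbability μ) (hν : IsRadonProbability ν)
    {I : ((X × Y) →ᵇ ℝ) → ℝ} (hI : I ∈ marginalMeans μ ν) : IsTight I := by
  intro ε hε
  obtain ⟨K, hK, hKμ⟩ := hμ.isTight_integral (ε / 4) (by positivity)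
  obtain ⟨L, hL, hLν⟩ := hν.isTight_integral (ε / 4) (by positivity)
  refine ⟨K ×ˢ L, hK.prod hL, fun f hf hfKL => ?_⟩
  -- By the tube lemma `f ≤ ε / 2` on a rectangle `U ×ˢ V` around `K ×ˢ L`; off this rectangle one
  -- of the cutoffs `φ`, `ψ` is `1`.
  obtain ⟨U, V, hU, hV, hKU, hLV, hUV⟩ := generalized_tube_lemma hK hL
    (isOpen_lt f.continuous continuous_const) fun z hz => (hfKL hz).trans_lt (half_pos hε)
  obtain ⟨φ, hφK, hφU, hφ⟩ :=
    exists_boundedContinuous_zero_one_of_isCompact_subset_isOpen hK hU hKU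
  obtain ⟨ψ, hψL, hψV, hψ⟩ :=
    exists_boundedContinuous_zero_one_of_isCompact_subset_isOpen hL hV hLV
  have hle : ∀ z, f z ≤ (const (X × Y) (ε / 2) + oplus φ ψ) z := fun z => by
    change f z ≤ ε / 2 + (φ z.1 + ψ z.2)
    have hf_le : f z ≤ 1 := (hf z).2
    have hφ_nonneg : 0 ≤ φ z.1 := (hφ z.1).1
    have hψ_nonneg : 0 ≤ ψ z.2 := (hψ z.2).1
    by_cases hzU : z.1 ∈ U
    · by_cases hzV : z.2 ∈ V
      · have hf_lt : f z < ε / 2 := hUV (mk_mem_prod hzU hzV)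
        linarith
      · have hψ_one : ψ z.2 = 1 := hψV hzV
        linarith
    · have hφ_one : φ z.1 = 1 := hφU hzU
      linarith
  calc I f ≤ I (const (X × Y) (ε / 2) + oplus φ ψ) := hI.1.mono hle
    _ = ε / 2 + (∫ x, φ x ∂μ + ∫ y, ψ y ∂ν) := by rw [hI.1.map_add, hI.1.map_const, hI.2]
    _ ≤ ε / 2 + (ε / 4 + ε / 4) := by gcongr; exacts [hKμ φ hφ hφK, hLν ψ hψ hψL]
    _ = ε := by ring

theorem chargeIntegral_mem_marginalMeans {m : zeroAlgebra (X × Y) → ℝ}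
    (hm : m ∈ chargePlans μ ν) : chargeIntegral m ∈ marginalMeans μ ν :=
  ⟨(isProbabilityCharge_of_mem_unitCharges hm.1).isMean_chargeIntegral, hm.2⟩

theorem toCharge_mem_chargePlans [BorelSpace X] [BorelSpace Y] {γ : BorelMeasure (X × Y)}
    (hγ : γ ∈ transportPlans μ ν) : toCharge γ ∈ chargePlans μ ν := by
  borelize (X × Y)
  obtain ⟨hγ, rfl, rfl⟩ := hγ
  have := hγ.1
  refine ⟨measureReal_mem_unitCharges γ, fun φ ψ => ?_⟩
  rw [integral_map continuous_fst.aemeasurable (by fun_prop),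
    integral_map continuous_snd.aemeasurable (by fun_prop)]
  exact (chargeIntegral_measureReal γ _).trans ((isMean_integral γ).map_add _ _)

variable [T35Space X] [T35Space Y]

theorem injOn_toCharge (μ : Measure X) (ν : Measure Y) :
    InjOn toCharge (transportPlans μ ν) := by
  borelize (X × Y)
  intro γ hγ η hη h
  have := hγ.1.1
  have := hη.1.1
  have := hγ.1.innerRegularCompactLTTop
  have := hη.1.innerRegularCompactLTTop
  refine measure_ext_of_integral_eq fun f => ?_
  calc ∫ z, f z ∂γ = chargeIntegral (toCharge γ) f := (chargeIntegral_measureReal γ f).symm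
    _ = chargeIntegral (toCharge η) f := by rw [h]
    _ = ∫ z, f z ∂η := chargeIntegral_measureReal η f

theorem chargeLowerIntegral_toCharge {c : X × Y → EReal} (hc : LowerSemicontinuous c)
    (hb : ∃ b : ℝ, ∀ z, (b : EReal) ≤ c z) {γ : BorelMeasure (X × Y)}
    (hγ : γ ∈ transportPlans μ ν) : chargeLowerIntegral (toCharge γ) c = planCost c γ := by
  borelize (X × Y)
  have := hγ.1.1
  have := hγ.1.innerRegularCompactLTTop
  refine Eq.trans ?_ (extIntegral_eq_iSup_integral hc hb).symm
  exact iSup_congr fun f => iSup_congr fun _ => congrArg _ (chargeIntegral_measureReal γ f)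

variable [BorelSpace X] [BorelSpace Y]

theorem exists_transportPlan_of_mem_marginalMeans (hμ : IsRadonProbability μ)
    (hν : IsRadonProbability ν) {I : ((X × Y) →ᵇ ℝ) → ℝ} (hI : I ∈ marginalMeans μ ν) :
    ∃ γ ∈ transportPlans μ ν, chargeIntegral (toCharge γ) = I := by
  borelize (X × Y)
  obtain ⟨γ, hγ, hγI⟩ := hI.1.exists_isRadonProbability (isTight_of_mem_marginalMeans hμ hν hI)
  have := hγ.1
  refine ⟨γ, ⟨hγ, ?_, ?_⟩, funext fun f => (chargeIntegral_measureReal γ f).trans (hγI f)⟩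
  · refine hγ.map_eq_of_integral_eq hμ continuous_fst fun φ => ?_
    simpa [← hγI] using hI.2 φ 0
  · refine hγ.map_eq_of_integral_eq hν continuous_snd fun ψ => ?_
    simpa [← hγI] using hI.2 0 ψ

theorem bijOn_toCharge (hμ : IsRadonProbability μ) (hν : IsRadonProbability ν) :
    BijOn toCharge (transportPlans μ ν) (chargePlans μ ν) := by
  refine ⟨fun γ => toCharge_mem_chargePlans, injOn_toCharge μ ν, fun m hm => ?_⟩
  obtain ⟨γ, hγ, hγm⟩ := exists_transportPlan_of_mem_marginalMeans hμ hν
    (chargeIntegral_mem_marginalMeans hm)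
  exact ⟨γ, hγ, unitCharges_ext (toCharge_mem_chargePlans hγ).1 hm.1 (congrFun hγm)⟩

theorem exists_planCost_eq_valueKP (hμ : IsRadonProbability μ) (hν : IsRadonProbability ν)
    {c : X × Y → EReal} (hc : LowerSemicontinuous c) (hb : ∃ b : ℝ, ∀ z, (b : EReal) ≤ c z)
    (hv : valueKP μ ν c < ⊤) : ∃ γ ∈ transportPlans μ ν, planCost c γ = valueKP μ ν c := by
  have hmean {γ : BorelMeasure (X × Y)} (hγ : γ ∈ transportPlans μ ν) :
      chargeIntegral (toCharge γ) ∈ marginalMeans μ ν :=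
    chargeIntegral_mem_marginalMeans (toCharge_mem_chargePlans hγ)
  have hne : (marginalMeans μ ν).Nonempty := by
    simp only [valueKP, iInf_lt_iff] at hv
    obtain ⟨γ, hγ, -⟩ := hv
    exact ⟨_, hmean hγ⟩
  have hlsc : LowerSemicontinuous fun I : ((X × Y) →ᵇ ℝ) → ℝ =>
      ⨆ (f : (X × Y) →ᵇ ℝ) (_ : ∀ z, ((f z : ℝ) : EReal) ≤ c z), ((I f : ℝ) : EReal) :=
    lowerSemicontinuous_biSup fun f _ =>
      (continuous_coe_real_ereal.comp (continuous_apply f)).lowerSemicontinuous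
  obtain ⟨I, hI, hmin⟩ := (hlsc.lowerSemicontinuousOn _).exists_isMinOn hne
    (isCompact_marginalMeans μ ν)
  obtain ⟨γ, hγ, rfl⟩ := exists_transportPlan_of_mem_marginalMeans hμ hν hI
  refine ⟨γ, hγ, le_antisymm (le_iInf₂ fun η hη => ?_) (iInf₂_le γ hγ)⟩
  rw [← chargeLowerIntegral_toCharge hc hb hγ, ← chargeLowerIntegral_toCharge hc hb hη]
  exact hmin (hmean hη)

end Plans

end KantorovichCharge

open MeasureTheory KantorovichCharge in
theorem mainTheorem5_general {X : Type*} {Y : Type*}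
    [TopologicalSpace X] [T35Space X] [MeasurableSpace X] [BorelSpace X]
    [TopologicalSpace Y] [T35Space Y] [MeasurableSpace Y] [BorelSpace Y]
    (μ : Measure X) (ν : Measure Y) (hμ : IsRadonProbability μ) (hν : IsRadonProbability ν) :
    Set.BijOn toCharge (transportPlans μ ν) (chargePlans μ ν) ∧
    ∀ c : X × Y → EReal, LowerSemicontinuous c → (∃ b : ℝ, ∀ z, (b : EReal) ≤ c z) →
      (∀ γ ∈ transportPlans μ ν, chargeLowerIntegral (toCharge γ) c = planCost c γ) ∧
      valueOP μ ν c = valueKP μ ν c ∧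
      (valueKP μ ν c < ⊤ → ∃ γ ∈ transportPlans μ ν, planCost c γ = valueKP μ ν c) := by
  have hbij := bijOn_toCharge hμ hν
  refine ⟨hbij, fun c hc hb => ⟨fun γ => chargeLowerIntegral_toCharge hc hb, ?_,
    exists_planCost_eq_valueKP hμ hν hc hb⟩⟩
  rw [valueOP, ← hbij.image_eq, iInf_image]
  exact iInf_congr fun γ => iInf_congr fun hγ => chargeLowerIntegral_toCharge hc hb hγ

open MeasureTheory KantorovichCharge in
theorem mainTheorem5 {X : Type*} {Y : Type*}
    [TopologicalSpace X] [T2Space X] [PerfectlyNormalSpace X] [MeasurableSpace X] [BorelSpace X]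
    [TopologicalSpace Y] [T2Space Y] [PerfectlyNormalSpace Y] [MeasurableSpace Y] [BorelSpace Y]
    (μ : Measure X) (ν : Measure Y) (hμ : IsRadonProbability μ) (hν : IsRadonProbability ν) :
    Set.BijOn toCharge (transportPlans μ ν) (chargePlans μ ν) ∧
    ∀ c ∈ lscBoundedBelow (X × Y),
      (∀ γ ∈ transportPlans μ ν, chargeLowerIntegral (toCharge γ) c = planCost c γ) ∧
      valueOP μ ν c = valueKP μ ν c ∧
      (valueKP μ ν c < ⊤ → ∃ γ ∈ transportPlans μ ν, planCost c γ = valueKP μ ν c) := by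
  obtain ⟨hbij, hcost⟩ := mainTheorem5_general μ ν hμ hν
  exact ⟨hbij, fun c hc => hcost c hc.1 hc.2.1⟩
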